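/- Let $k$ be a field, $R=k[x_1,\dots,x_n]$, $V$ a $k$-vector space with basis $x_1,\dots,x_n$, and let $\mathbb K$ be the Koszul complex with terms $\mathbb K_i=R\otimes_k\bigwedge^i V$ and $R$-linear differential $$\partial(1\otimes x_{j_1}\wedge\cdots\wedge x_{j_i})=\sum_{m=1}^{i}(-1)^{m+1}\,x_{j_m}\otimes x_{j_1}\wedge\cdots\wedge\widehat{x_{j_m}}\wedge\cdots\wedge x_{j_i}.$$ For a monomial ideal $I\subseteq R$ put $\mathbb K(I)=I\otimes_R\mathbb K$, which is $\mathbb N^n$-graded by giving $x^\nu\otimes x_{j_1}\wedge\cdots\wedge x_{j_i}$ the multidegree $\nu+e_{j_1}+\cdots+e_{j_i}$, and let $H_{i,\mu}(\mathbb K(I))$ be the component of multidegree $\mu$ of $H_i(\mathbb K(I))$. For $\mu\in\mathbb N^n$ let $\operatorname{supp}(\mu)=\{j:\mu_j\neq 0\}$, let $\operatorname{low}(\mu)_j=\max(\mu_j-1,0)$, and define the upper and the lower Koszul simplicial complexes of $I$ at $\mu$ by $$\Delta^I_\mu=\{\tau\in\{0,1\}^n:\ \tau\le\mu,\ x^{\mu-\tau}\in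 I\},\qquad \Delta^\mu_I=\{\tau\in\{0,1\}^n:\ \tau\le\mu,\ x^{\operatorname{low}(\mu)+\tau}\notin I\},$$ where a vector $\tau\in\{0,1\}^n$ is identified with the face $\{j:\tau_j=1\}$. A simplicial complex may be void (no faces at all, with all reduced (co)homology zero) or may consist of the empty face only (with $\tilde H_{-1}=\tilde H^{-1}=k$). Reduced simplicial homology $\tilde H_j$ and cohomology $\tilde H^j$ are taken with coefficients in $k$ and are zero for $j<-1$. Proposition. Let $I\subseteq R$ be a monomial ideal, $\mu\in\mathbb N^n$ and $i\ge 0$. Then there is an isomorphism of $k$-vector spaces $$H_{i,\mu}(\mathbb K(I))\;\cong\;\tilde H_{i-1}(\Delta^I_\mu).$$ Moreover, except in the degenerate case where $I=R$, $\mu=0$ and $i=0$, there is an isomorphism of $k$-vector spaces $$\tilde H_{i-1}(\Delta^I_\mu)\;\cong\;\tilde H^{\,|\operatorname{supp}(\mu)|-i-2}(\Delta^\mu_I).$$ -/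

import Mathlib

open scoped TensorProduct

noncomputable section

/-! ### Signs -/

/-- If `s = {j_1 < ... < j_i}` and `j = j_m`, this is the sign `(-1)^(m+1)`
(equivalently `(-1)^(m-1)`; note that `m - 1` elements of `s` are smaller than `j_m`). -/
def koszulSign {V : Type*} [LinearOrder V] (s : Finset V) (j : V) : ℤ :=
  (-1) ^ (s.filter (· < j)).card

/-- Removing two vertices in either order gives opposite signs. -/
theorem koszulSign_swap {V : Type*} [LinearOrder V] (s : Finset V) (j l : V)
    (hj : j ∈ s) (hjl : j < l) :
    koszulSign s j * koszulSign (s.erase j) l = -(koszulSign s l * koszulSign (s.erase l) j) := by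
  have h1 : (s.erase l).filter (· < j) = s.filter (· < j) := by
    ext a
    simp only [Finset.mem_filter, Finset.mem_erase]
    constructor
    · rintro ⟨⟨_, h⟩, h'⟩
      exact ⟨h, h'⟩
    · rintro ⟨h, h'⟩
      exact ⟨⟨(h'.trans hjl).ne, h⟩, h'⟩
  have h2 : (s.erase j).filter (· < l) = (s.filter (· < l)).erase j := by
    ext a
    simp only [Finset.mem_filter, Finset.mem_erase]
    tauto
  have h3 : (((s.filter (· < l)).erase j).card) + 1 = (s.filter (· < l)).card :=
    Finset.card_erase_add_one (by simp [hj, hjl])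
  unfold koszulSign
  rw [h1, h2, ← h3, pow_succ]
  ring

/-- The cancellation behind `∂ ∘ ∂ = 0`. -/
theorem koszulSign_sum_eq_zero {V : Type*} [LinearOrder V] {A : Type*} [AddCommGroup A]
    (s : Finset V) (g : V → V → A) (hg : ∀ j l, g j l = g l j) :
    ∑ j ∈ s, ∑ l ∈ s.erase j, (koszulSign s j * koszulSign (s.erase j) l) • g j l = 0 := by
  rw [Finset.sum_sigma']
  refine Finset.sum_involution (fun a _ => ⟨a.2, a.1⟩) ?_ ?_ ?_ ?_
  · rintro ⟨j, l⟩ h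
    simp only [Finset.mem_sigma, Finset.mem_erase] at h
    obtain ⟨hj, hlj, hl⟩ := h
    rw [hg l j, ← add_smul]
    rcases lt_or_gt_of_ne hlj with h' | h'
    · rw [koszulSign_swap s l j hl h']
      simp
    · rw [koszulSign_swap s j l hj h']
      simp
  · rintro ⟨j, l⟩ h _ h'
    simp only [Finset.mem_sigma, Finset.mem_erase] at h
    simp only [Sigma.mk.injEq, heq_eq_eq] at h'
    exact h.2.1 h'.1
  · rintro ⟨j, l⟩ h
    simp only [Finset.mem_sigma, Finset.mem_erase] at h ⊢
    exact ⟨h.2.2, fun e => h.2.1 e.symm, h.1⟩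
  · rintro ⟨j, l⟩ _
    rfl

/-! ### Homology as a quotient cycles modulo boundaries -/

section Quotient

variable {R A : Type*} [Ring R] [AddCommGroup A] [Module R A]

/-- The quotient `Z / B` of a submodule `Z` (cycles) by a submodule `B ≤ Z` (boundaries). -/
def CyclesModBoundaries (Z B : Submodule R A) : Type _ := Z ⧸ B.submoduleOf Z

instance (Z B : Submodule R A) : AddCommGroup (CyclesModBoundaries Z B) :=
  inferInstanceAs (AddCommGroup (Z ⧸ B.submoduleOf Z))

instance (Z B : Submodule R A) : Module R (CyclesModBoundaries Z B) :=
  inferInstanceAs (Module R (Z ⧸ B.submoduleOf Z))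

/-- The map sending a cycle to its homology class. -/
def toHomologyClass (Z B : Submodule R A) : Z →ₗ[R] CyclesModBoundaries Z B :=
  (B.submoduleOf Z).mkQ

end Quotient

/-! ### The Koszul complex -/

section Koszul

variable (k : Type*) [Field k] (n : ℕ)

/-- The `i`-th term `R ⊗_k ⋀^i V` of the Koszul complex, with `R = k[x_1, ..., x_n]` and `V = k^n`. -/
abbrev KoszulTerm (i : ℕ) : Type _ :=
  MvPolynomial (Fin n) k ⊗[k] (⋀[k]^i (Fin n → k))

/-- The `R`-basis of `R ⊗_k ⋀^i V` consisting of the elements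
`1 ⊗ x_{j_1} ∧ ... ∧ x_{j_i}` with `j_1 < ... < j_i`, indexed by `{j_1, ..., j_i}`. -/
def koszulBasis (i : ℕ) :
    Module.Basis (Set.powersetCard (Fin n) i) (MvPolynomial (Fin n) k) (KoszulTerm k n i) :=
  Algebra.TensorProduct.basis (MvPolynomial (Fin n) k)
    ((Pi.basisFun k (Fin n)).exteriorPower i)

variable {n} in
/-- The set `s \ {j}` as a set with `i` elements, for `j ∈ s` and `s` with `i + 1` elements. -/
def cardErase {i : ℕ} (s : Set.powersetCard (Fin n) (i + 1)) (j : Fin n) (hj : j ∈ s.1) :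
    Set.powersetCard (Fin n) i :=
  ⟨s.1.erase j, by
    have h : s.1.card = i + 1 := s.2
    change (s.1.erase j).card = i
    have h' := Finset.card_erase_add_one hj
    omega⟩

/-- The Koszul differential `∂ : R ⊗_k ⋀^(i+1) V → R ⊗_k ⋀^i V`, i.e. the `R`-linear map with
`∂(1 ⊗ x_{j_1} ∧ ... ∧ x_{j_{i+1}}) = ∑_m (-1)^(m+1) x_{j_m} ⊗ (... omit x_{j_m} ...)`. -/
def koszulD (i : ℕ) :
    KoszulTerm k n (i + 1) →ₗ[MvPolynomial (Fin n) k] KoszulTerm k n i :=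
  (koszulBasis k n (i + 1)).constr ℕ fun s =>
    ∑ j ∈ s.1.attach, koszulSign s.1 j.1 •
      ((MvPolynomial.X j.1 : MvPolynomial (Fin n) k) • koszulBasis k n i (cardErase s j.1 j.2))

/-- The Koszul complex is a complex. -/
theorem koszulD_comp_koszulD (i : ℕ) : koszulD k n i ∘ₗ koszulD k n (i + 1) = 0 := by
  refine (koszulBasis k n (i + 2)).ext fun s => ?_
  have hD : ∀ (m : ℕ) (t : Set.powersetCard (Fin n) (m + 1)),
      koszulD k n m (koszulBasis k n (m + 1) t) = ∑ j ∈ t.1.attach, koszulSign t.1 j.1 •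
      ((MvPolynomial.X j.1 : MvPolynomial (Fin n) k) • koszulBasis k n m (cardErase t j.1 j.2)) :=
    fun m t => by unfold koszulD; rw [Module.Basis.constr_basis]
  let e : Finset (Fin n) → KoszulTerm k n i := fun t =>
    if h : t.card = i then koszulBasis k n i ⟨t, h⟩ else 0
  have he : ∀ t : Set.powersetCard (Fin n) i, koszulBasis k n i t = e t.1 := fun t => by
    have h : t.1.card = i := t.2
    simp only [e, h, dif_pos]
  rw [LinearMap.comp_apply, hD, map_sum, LinearMap.zero_apply]
  rw [← koszulSign_sum_eq_zero s.1 (fun j l => (MvPolynomial.X j * MvPolynomial.X l :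
      MvPolynomial (Fin n) k) • e ((s.1.erase j).erase l)) (fun j l => by
        rw [mul_comm, Finset.erase_right_comm])]
  rw [← Finset.sum_attach s.1]
  refine Finset.sum_congr rfl fun j _ => ?_
  rw [map_zsmul, map_smul, hD, ← Finset.sum_attach (s.1.erase j.1), Finset.smul_sum,
    Finset.smul_sum]
  refine Finset.sum_congr rfl fun l _ => ?_
  rw [he, smul_comm (MvPolynomial.X j.1 : MvPolynomial (Fin n) k), smul_smul, smul_smul]
  rfl

variable (M : Type*) [AddCommGroup M] [Module k M] [Module (MvPolynomial (Fin n) k) M]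
  [IsScalarTower k (MvPolynomial (Fin n) k) M]

/-- The term `M ⊗_R K_i` of the Koszul complex `K(M) = M ⊗_R K` of an `R`-module `M`. We regard
`K(M)` as a complex of `k`-vector spaces. -/
def KoszulChain (i : ℕ) : Type _ :=
  M ⊗[MvPolynomial (Fin n) k] KoszulTerm k n i

instance (i : ℕ) : AddCommGroup (KoszulChain k n M i) :=
  inferInstanceAs (AddCommGroup (M ⊗[MvPolynomial (Fin n) k] KoszulTerm k n i))

instance (i : ℕ) : Module k (KoszulChain k n M i) :=
  inferInstanceAs (Module k (M ⊗[MvPolynomial (Fin n) k] KoszulTerm k n i))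

variable {n M} in
/-- The element `m ⊗ (1 ⊗ x_{j_1} ∧ ... ∧ x_{j_i})` of `M ⊗_R K_i`, for
`s = {j_1 < ... < j_i}`. -/
def koszulElem {i : ℕ} (m : M) (s : Set.powersetCard (Fin n) i) : KoszulChain k n M i :=
  m ⊗ₜ[MvPolynomial (Fin n) k] koszulBasis k n i s

/-- The differential `id_M ⊗ ∂ : M ⊗_R K_{i+1} → M ⊗_R K_i` of the Koszul complex of `M`. -/
def koszulDiff (i : ℕ) : KoszulChain k n M (i + 1) →ₗ[k] KoszulChain k n M i :=
  LinearMap.restrictScalars (M := M ⊗[MvPolynomial (Fin n) k] KoszulTerm k n (i + 1))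
    (M₂ := M ⊗[MvPolynomial (Fin n) k] KoszulTerm k n i) k ((koszulD k n i).lTensor M)

/-- Koszul cycles of degree `i`; in degree `0` everything is a cycle. -/
def koszulCycles : (i : ℕ) → Submodule k (KoszulChain k n M i)
  | 0 => ⊤
  | i + 1 => LinearMap.ker (koszulDiff k n M i)

/-- Koszul boundaries of degree `i`. -/
def koszulBoundaries (i : ℕ) : Submodule k (KoszulChain k n M i) :=
  LinearMap.range (koszulDiff k n M i)

theorem koszulBoundaries_le_koszulCycles (i : ℕ) :
    koszulBoundaries k n M i ≤ koszulCycles k n M i := by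
  cases i with
  | zero => exact le_top
  | succ i =>
    have key : ∀ y : M ⊗[MvPolynomial (Fin n) k] KoszulTerm k n (i + 1 + 1),
        (koszulD k n i).lTensor M ((koszulD k n (i + 1)).lTensor M y) = 0 := fun y => by
      rw [← LinearMap.comp_apply, ← LinearMap.lTensor_comp, koszulD_comp_koszulD]
      simp
    rintro _ ⟨y, rfl⟩
    exact key y

/-- The Koszul homology `H_i(K(M))`. -/
abbrev KoszulHomology (i : ℕ) : Type _ :=
  CyclesModBoundaries (koszulCycles k n M i) (koszulBoundaries k n M i)

end Koszul

/-! ### Monomial ideals and multidegrees -/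

/-- A monomial ideal is an ideal generated by a set of monomials. -/
def IsMonomialIdeal {k : Type*} [Field k] {n : ℕ} (I : Ideal (MvPolynomial (Fin n) k)) : Prop :=
  ∃ A : Set (Fin n →₀ ℕ),
    I = Ideal.span ((fun a => (MvPolynomial.monomial a (1 : k))) '' A)

/-- The squarefree vector in `ℕ^n` with support `τ`. -/
def sqfreeVec {n : ℕ} (τ : Finset (Fin n)) : Fin n →₀ ℕ :=
  Finsupp.indicator τ fun _ _ => 1

/-- The lowered multidegree: subtract `1` from every coordinate in the support. -/
def lowered {n : ℕ} (μ : Fin n →₀ ℕ) : Fin n →₀ ℕ :=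
  μ.mapRange (fun a => a - 1) rfl

/-- The multidegree `μ` part of `I ⊗_R K_i`: the `k`-span of the elements
`x^ν ⊗ x_{j_1} ∧ ... ∧ x_{j_i}` with `x^ν ∈ I` and `ν + e_{j_1} + ... + e_{j_i} = μ`. -/
def koszulMultidegree {k : Type*} [Field k] {n : ℕ} (I : Ideal (MvPolynomial (Fin n) k))
    (i : ℕ) (μ : Fin n →₀ ℕ) :
    Submodule k (KoszulChain k n I i) :=
  Submodule.span k
    {z | ∃ (ν : Fin n →₀ ℕ) (hν : MvPolynomial.monomial ν (1 : k) ∈ I)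
      (s : Set.powersetCard (Fin n) i), ν + sqfreeVec s.1 = μ ∧
        z = koszulElem k (⟨MvPolynomial.monomial ν 1, hν⟩ : I) s}

/-- `H_{i,μ}(K(I))`: the multidegree `μ` component of `H_i(K(I))`, i.e. the `k`-subspace of
homology classes of cycles that are homogeneous of multidegree `μ`. -/
def multigradedKoszulHomology {k : Type*} [Field k] {n : ℕ} (I : Ideal (MvPolynomial (Fin n) k))
    (i : ℕ) (μ : Fin n →₀ ℕ) : Submodule k (KoszulHomology k n I i) :=
  ((koszulMultidegree I i μ).submoduleOf (koszulCycles k n I i)).map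
    (toHomologyClass (koszulCycles k n I i) (koszulBoundaries k n I i))

/-! ### Simplicial complexes and reduced (co)homology -/

/-- A (possibly void) simplicial complex on a set of potential vertices `V`: a set of finite subsets
closed under passing to subsets. The empty set is a face of every complex but the void one. -/
abbrev SimplComplex (V : Type*) : Type _ := LowerSet (Finset V)

section Simplicial

variable (k : Type*) [Field k] {V : Type*} [LinearOrder V] (Δ : SimplComplex V)

/-- The faces of dimension `j`, that is, with `j + 1` vertices (`j = -1` for the empty face). -/
def SimplFace (j : ℤ) : Type _ := {F : Finset V // F ∈ Δ ∧ (F.card : ℤ) = j + 1}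

/-- The space of reduced simplicial `j`-chains with coefficients in `k`. -/
abbrev SimplChain (j : ℤ) : Type _ := SimplFace Δ j →₀ k

variable {Δ} in
/-- The face `F \ {v}`. -/
def SimplFace.erase {p q : ℤ} (h : q + 1 = p) (F : SimplFace Δ p) (v : V) (hv : v ∈ F.1) :
    SimplFace Δ q :=
  ⟨F.1.erase v, Δ.lower (Finset.erase_subset v F.1) F.2.1, by
    have h1 := Finset.card_erase_add_one hv
    have h2 := F.2.2
    omega⟩

/-- The simplicial boundary map `∂ : C_p → C_q`, where `p = q + 1`, with
`∂{v_0 < ... < v_p} = ∑_m (-1)^m {v_0, ..., v_p} \ {v_m}`. -/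
def simplBoundary (p q : ℤ) (h : q + 1 = p) : SimplChain k Δ p →ₗ[k] SimplChain k Δ q :=
  Finsupp.linearCombination k fun F =>
    ∑ v ∈ F.1.attach, koszulSign F.1 v.1 • Finsupp.single (F.erase h v.1 v.2) (1 : k)

/-- The reduced chain complex of a simplicial complex is a complex. -/
theorem simplBoundary_comp_simplBoundary (p q r : ℤ) (h : q + 1 = p) (h' : r + 1 = q) :
    simplBoundary k Δ q r h' ∘ₗ simplBoundary k Δ p q h = 0 := by
  classical
  refine Finsupp.lhom_ext' fun F => LinearMap.ext_ring ?_
  have hD : ∀ (a b : ℤ) (hab : b + 1 = a) (G : SimplFace Δ a),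
      simplBoundary k Δ a b hab (Finsupp.single G 1) =
      ∑ v ∈ G.1.attach, koszulSign G.1 v.1 • Finsupp.single (G.erase hab v.1 v.2) (1 : k) :=
    fun a b hab G => by
      unfold simplBoundary
      rw [Finsupp.linearCombination_single, one_smul]
  let e : Finset V → SimplChain k Δ r := fun t =>
    if ht : t ∈ Δ ∧ (t.card : ℤ) = r + 1 then Finsupp.single ⟨t, ht⟩ 1 else 0
  have he : ∀ t : SimplFace Δ r, Finsupp.single t (1 : k) = e t.1 := fun t => by
    simp only [e, t.2, and_self, dif_pos]
    rfl
  change simplBoundary k Δ q r h' (simplBoundary k Δ p q h (Finsupp.single F 1)) = 0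
  rw [hD, map_sum]
  rw [← koszulSign_sum_eq_zero F.1 (fun j l => e ((F.1.erase j).erase l)) (fun j l => by
        rw [Finset.erase_right_comm])]
  rw [← Finset.sum_attach F.1]
  refine Finset.sum_congr rfl fun j _ => ?_
  rw [map_zsmul, hD, ← Finset.sum_attach (F.1.erase j.1), Finset.smul_sum]
  refine Finset.sum_congr rfl fun l _ => ?_
  rw [he, smul_smul]
  rfl

/-- Simplicial cycles of degree `j`. -/
def simplCycles (j : ℤ) : Submodule k (SimplChain k Δ j) :=
  LinearMap.ker (simplBoundary k Δ j (j - 1) (sub_add_cancel j 1))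

/-- Simplicial boundaries of degree `j`. -/
def simplBoundaries (j : ℤ) : Submodule k (SimplChain k Δ j) :=
  LinearMap.range (simplBoundary k Δ (j + 1) j rfl)

theorem simplBoundaries_le_simplCycles (j : ℤ) :
    simplBoundaries k Δ j ≤ simplCycles k Δ j := by
  rintro _ ⟨y, rfl⟩
  exact LinearMap.congr_fun (simplBoundary_comp_simplBoundary k Δ _ _ _ _ _) y

/-- The reduced simplicial homology `H̃_j(Δ; k)`, for an arbitrary integer `j`. -/
abbrev ReducedHomology (j : ℤ) : Type _ :=
  CyclesModBoundaries (simplCycles k Δ j) (simplBoundaries k Δ j)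

/-- The space of reduced simplicial `j`-cochains. -/
abbrev SimplCochain (j : ℤ) : Type _ := Module.Dual k (SimplChain k Δ j)

/-- The simplicial coboundary map `C^q → C^p`, where `p = q + 1`: the transpose of `∂`. -/
def simplCoboundary (q p : ℤ) (h : q + 1 = p) : SimplCochain k Δ q →ₗ[k] SimplCochain k Δ p :=
  (simplBoundary k Δ p q h).dualMap

/-- Simplicial cocycles of degree `j`. -/
def simplCocycles (j : ℤ) : Submodule k (SimplCochain k Δ j) :=
  LinearMap.ker (simplCoboundary k Δ j (j + 1) rfl)

/-- Simplicial coboundaries of degree `j`. -/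
def simplCoboundaries (j : ℤ) : Submodule k (SimplCochain k Δ j) :=
  LinearMap.range (simplCoboundary k Δ (j - 1) j (sub_add_cancel j 1))

theorem simplCoboundaries_le_simplCocycles (j : ℤ) :
    simplCoboundaries k Δ j ≤ simplCocycles k Δ j := by
  rintro _ ⟨y, rfl⟩
  refine LinearMap.ext fun x => ?_
  have h := LinearMap.congr_fun
    (simplBoundary_comp_simplBoundary k Δ (j + 1) j (j - 1) rfl (sub_add_cancel j 1)) x
  exact (congrArg y h).trans (map_zero y)

/-- The reduced simplicial cohomology `H̃^j(Δ; k)`, for an arbitrary integer `j`. -/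
abbrev ReducedCohomology (j : ℤ) : Type _ :=
  CyclesModBoundaries (simplCocycles k Δ j) (simplCoboundaries k Δ j)

end Simplicial

/-! ### The Koszul simplicial complexes -/

theorem sqfreeVec_mono {n : ℕ} {σ τ : Finset (Fin n)} (h : σ ⊆ τ) : sqfreeVec σ ≤ sqfreeVec τ := by
  classical
  intro a
  simp only [sqfreeVec, Finsupp.indicator_apply]
  by_cases ha : a ∈ σ
  · simp [ha, h ha]
  · simp [ha]

theorem monomial_mem_of_le {k : Type*} [Field k] {n : ℕ} (I : Ideal (MvPolynomial (Fin n) k))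
    {a b : Fin n →₀ ℕ} (h : a ≤ b) (ha : MvPolynomial.monomial a (1 : k) ∈ I) :
    MvPolynomial.monomial b (1 : k) ∈ I := by
  have hb : MvPolynomial.monomial b (1 : k) =
      MvPolynomial.monomial (b - a) 1 * MvPolynomial.monomial a 1 := by
    rw [MvPolynomial.monomial_mul, tsub_add_cancel_of_le h, one_mul]
  rw [hb]
  exact I.mul_mem_left _ ha

/-- The upper Koszul simplicial complex of `I` at `μ`: the squarefree vectors `τ ≤ μ` such that
`x^(μ - τ) ∈ I`. -/
def upperKoszulComplex {k : Type*} [Field k] {n : ℕ} (I : Ideal (MvPolynomial (Fin n) k))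
    (μ : Fin n →₀ ℕ) : SimplComplex (Fin n) where
  carrier := {τ | sqfreeVec τ ≤ μ ∧ MvPolynomial.monomial (μ - sqfreeVec τ) (1 : k) ∈ I}
  lower' := by
    rintro τ σ hστ ⟨h1, h2⟩
    exact ⟨(sqfreeVec_mono hστ).trans h1,
      monomial_mem_of_le I (tsub_le_tsub_left (sqfreeVec_mono hστ) μ) h2⟩

/-- The lower Koszul simplicial complex of `I` at `μ`: the squarefree vectors `τ ≤ μ` such that
`x^(low(μ) + τ) ∉ I`. -/
def lowerKoszulComplex {k : Type*} [Field k] {n : ℕ} (I : Ideal (MvPolynomial (Fin n) k))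
    (μ : Fin n →₀ ℕ) : SimplComplex (Fin n) where
  carrier := {τ | sqfreeVec τ ≤ μ ∧ MvPolynomial.monomial (lowered μ + sqfreeVec τ) (1 : k) ∉ I}
  lower' := by
    rintro τ σ hστ ⟨h1, h2⟩
    exact ⟨(sqfreeVec_mono hστ).trans h1,
      fun h => h2 (monomial_mem_of_le I (by gcongr; exact sqfreeVec_mono hστ) h)⟩

end

/-! The first isomorphism holds already for chains. Since x^ν ⊗ x_τ has multidegree μ only if ν = μ
- τ, the multidegree μ strand of K(I) has a basis indexed by the faces τ of the upper complex.
Multiplying x^(μ-τ) by x_j gives x^(μ-(τ∖j)), so on this basis the Koszul differential is the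
simplicial boundary, with the same signs and the degree shifted by one. `chainToKoszul` includes the
strand and `koszulToChain` is a retraction onto it. Both commute with the differentials, for the
retraction because I is monomial, so cycles and boundaries correspond.

The second isomorphism is Alexander duality. For τ ⊆ S = supp(μ) one has low(μ) + τ = μ - (S∖τ), so
the lower complex Γ consists of the complements in S of the nonfaces of the upper complex Δ
(`mem_lowerKoszulComplex_iff`). Up to the signs `complSign`, taking complements identifies cochains
of Γ with chains of the full simplex on S modulo chains of Δ, and coboundaries with boundaries
(`complChain_simplCoboundary`). For nonempty S the full simplex is acyclic
(`fullBoundary_coneChain_min'`), so the connecting map of the pair (full simplex, Δ) is an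
isomorphism from relative homology in degree p + 1 to the reduced homology of Δ in degree p
(`alexanderDuality`). For μ = 0 the simplex is not acyclic, and both sides vanish outside the
degenerate case.

Chains and cochains are extended by zero to functions on all finite sets, so that Δ, Γ and the full
simplex, in all dimensions, can be compared inside one space. -/

noncomputable section

/-! ### Comparing quotients of cycles by boundaries -/

section Quotient

variable {R A A' : Type*} [Ring R] [AddCommGroup A] [Module R A] [AddCommGroup A'] [Module R A']

/-- A linear map sending cycles to cycles, reflecting boundaries among cycles, and hitting every
homology class, induces an isomorphism on homology. -/
theorem nonempty_cyclesModBoundaries_equiv {Z B : Submodule R A} {Z' B' : Submodule R A'}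
    (f : A →ₗ[R] A') (hZ : ∀ z ∈ Z, f z ∈ Z') (hB : ∀ z ∈ Z, f z ∈ B' ↔ z ∈ B)
    (hsurj : ∀ z' ∈ Z', ∃ z ∈ Z, z' - f z ∈ B') :
    Nonempty (CyclesModBoundaries Z B ≃ₗ[R] CyclesModBoundaries Z' B') := by
  let T : Z →ₗ[R] (Z' ⧸ B'.submoduleOf Z') := (B'.submoduleOf Z').mkQ ∘ₗ f.restrict hZ
  have hker : B.submoduleOf Z = LinearMap.ker T := by
    ext z
    simp only [T, LinearMap.mem_ker, LinearMap.comp_apply, Submodule.mkQ_apply,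
      Submodule.Quotient.mk_eq_zero]
    exact (hB z.1 z.2).symm
  have hT : Function.Surjective T := by
    intro y
    obtain ⟨z', rfl⟩ := Submodule.mkQ_surjective _ y
    obtain ⟨z, hz, h⟩ := hsurj z'.1 z'.2
    exact ⟨⟨z, hz⟩, ((Submodule.Quotient.eq (B'.submoduleOf Z')).2 h).symm⟩
  exact ⟨(Submodule.quotEquivOfEq _ _ hker).trans (T.quotKerEquivOfSurjective hT)⟩

theorem subsingleton_cyclesModBoundaries [Subsingleton A] (Z B : Submodule R A) :
    Subsingleton (CyclesModBoundaries Z B) :=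
  inferInstanceAs (Subsingleton (Z ⧸ B.submoduleOf Z))

end Quotient

/-! ### Signs -/

section Sign

variable {V : Type*} [LinearOrder V]

theorem koszulSign_mul_self (s : Finset V) (v : V) : koszulSign s v * koszulSign s v = 1 := by
  unfold koszulSign
  rw [← mul_pow]
  simp

theorem koszulSign_insert_self (s : Finset V) (v : V) :
    koszulSign (insert v s) v = koszulSign s v := by
  unfold koszulSign
  rw [Finset.filter_insert, if_neg (lt_irrefl v)]

theorem koszulSign_mul_koszulSign_sdiff {S F : Finset V} (hF : F ⊆ S) (v : V) :
    koszulSign F v * koszulSign (S \ F) v = koszulSign S v := by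
  unfold koszulSign
  rw [← pow_add, ← Finset.card_union_of_disjoint, ← Finset.filter_union,
    Finset.union_sdiff_of_subset hF]
  exact Finset.disjoint_filter_filter Finset.disjoint_sdiff

theorem koszulSign_eq_one_of_forall_le {s : Finset V} {v : V} (h : ∀ u ∈ s, v ≤ u) :
    koszulSign s v = 1 := by
  unfold koszulSign
  rw [Finset.filter_false_of_mem fun u hu => not_lt.2 (h u hu)]
  rfl

/-- The product of the signs of the elements of `F` in `S`, which makes taking complements in `S`
compatible with boundaries and coboundaries. -/
def complSign (S F : Finset V) : ℤ := ∏ v ∈ F, koszulSign S v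

theorem complSign_mul_self (S F : Finset V) : complSign S F * complSign S F = 1 := by
  unfold complSign
  rw [← Finset.prod_mul_distrib]
  exact Finset.prod_eq_one fun v _ => koszulSign_mul_self S v

/-- The elements of S below v split between F and S∖F. The new factor of the product, the sign of v
in S, therefore absorbs the boundary sign of v in F and leaves the coboundary sign of v in S∖F. -/
theorem koszulSign_mul_complSign_insert {S F : Finset V} (hF : F ⊆ S) {v : V} (hv : v ∉ F) :
    koszulSign (insert v F) v * complSign S (insert v F) =
      complSign S F * koszulSign (S \ F) v := by
  rw [koszulSign_insert_self, complSign, Finset.prod_insert hv,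
    ← koszulSign_mul_koszulSign_sdiff hF v, ← mul_assoc, ← mul_assoc, koszulSign_mul_self]
  unfold complSign
  ring

end Sign

/-! ### Chains on a full simplex, as functions on finite sets -/

section FullSimplex

variable (k : Type*) [Field k] {V : Type*} [LinearOrder V]

/-- The boundary map of the full simplex on `S`, with chains regarded as functions. -/
def fullBoundary (S : Finset V) : (Finset V → k) →ₗ[k] (Finset V → k) where
  toFun w F := ∑ v ∈ S \ F, koszulSign (insert v F) v • w (insert v F)
  map_add' w w' := by
    ext F
    simp [Finset.sum_add_distrib]
  map_smul' c w := by
    ext F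
    simp only [Pi.smul_apply, RingHom.id_apply, Finset.smul_sum]
    exact Finset.sum_congr rfl fun v _ => smul_comm _ _ _

variable {k}

theorem fullBoundary_apply (S : Finset V) (w : Finset V → k) (F : Finset V) :
    fullBoundary k S w F = ∑ v ∈ S \ F, koszulSign (insert v F) v • w (insert v F) := rfl

/-- The terms for (j, l) and (l, j) add the same two vertices in opposite orders, so they cancel by
`koszulSign_swap`. -/
theorem fullBoundary_fullBoundary (S : Finset V) (w : Finset V → k) :
    fullBoundary k S (fullBoundary k S w) = 0 := by
  ext F
  simp only [fullBoundary_apply, Finset.smul_sum, smul_smul, Pi.zero_apply]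
  rw [Finset.sum_sigma']
  refine Finset.sum_involution (fun a _ => ⟨a.2, a.1⟩) ?_ ?_ ?_ ?_
  · rintro ⟨j, l⟩ h
    simp only [Finset.mem_sigma, Finset.mem_sdiff, Finset.mem_insert, not_or] at h
    obtain ⟨⟨hj, hjF⟩, hl, hlj, hlF⟩ := h
    have e1 : (insert l (insert j F)).erase l = insert j F :=
      Finset.erase_insert (by simp [hlj, hlF])
    have e2 : (insert l (insert j F)).erase j = insert l F := by
      rw [Finset.insert_comm]
      exact Finset.erase_insert (by simp [Ne.symm hlj, hjF])
    dsimp only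
    rw [Finset.insert_comm j l F, ← add_smul]
    rcases lt_or_gt_of_ne hlj with h' | h'
    · have := koszulSign_swap (insert l (insert j F)) l j (by simp) h'
      rw [e1, e2] at this
      rw [mul_comm, this, mul_comm (koszulSign (insert l F) l)]
      simp
    · have := koszulSign_swap (insert l (insert j F)) j l (by simp) h'
      rw [e1, e2] at this
      rw [mul_comm (koszulSign (insert l F) l), this, mul_comm (koszulSign (insert j F) j)]
      simp
  · rintro ⟨j, l⟩ h _ h'
    simp only [Finset.mem_sigma, Finset.mem_sdiff, Finset.mem_insert, not_or] at h
    simp only [Sigma.mk.injEq, heq_eq_eq] at h'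
    exact h.2.2.1 h'.1
  · rintro ⟨j, l⟩ h
    simp only [Finset.mem_sigma, Finset.mem_sdiff, Finset.mem_insert, not_or] at h ⊢
    exact ⟨⟨h.2.1, h.2.2.2⟩, h.1.1, fun e => h.2.2.1 e.symm, h.1.2⟩
  · rintro ⟨j, l⟩ _
    rfl

/-- The cone over a chain with apex `v`. -/
def coneChain (v : V) (w : Finset V → k) : Finset V → k :=
  fun F => if v ∈ F then w (F.erase v) else 0

/-- The full simplex on a nonempty set is acyclic. -/
theorem fullBoundary_coneChain_min' {S : Finset V} (hS : S.Nonempty) {w : Finset V → k}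
    (hw : ∀ F, w F ≠ 0 → F ⊆ S) (hD : fullBoundary k S w = 0) :
    fullBoundary k S (coneChain (S.min' hS) w) = w := by
  set a := S.min' hS with ha
  have haS : a ∈ S := S.min'_mem hS
  -- With the least vertex as apex, its sign is +1 in every face, so the cone needs no sign
  -- correction.
  have hmin : ∀ F : Finset V, F ⊆ S → koszulSign F a = 1 := fun F hF =>
    koszulSign_eq_one_of_forall_le fun u hu => S.min'_le u (hF hu)
  ext F
  by_cases hF : F ⊆ S
  swap
  · rw [not_ne_iff.1 (mt (hw F) hF), fullBoundary_apply]
    refine Finset.sum_eq_zero fun v hv => ?_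
    obtain ⟨u, huF, huS⟩ := Finset.not_subset.1 hF
    have hne : u ≠ a := fun h => huS (h ▸ haS)
    have : coneChain a w (insert v F) = 0 := by
      unfold coneChain
      split_ifs with h
      · refine not_ne_iff.1 (mt (hw _) fun h' => huS (h' ?_))
        simp [hne, huF]
      · rfl
    rw [this, smul_zero]
  rw [fullBoundary_apply]
  by_cases haF : a ∈ F
  -- The cycle condition at F∖a expresses w F through the values at v ∪ (F∖a) with v ∉ F. These are
  -- the values that the boundary of the cone collects at F.
  · have h0 := congrFun hD (F.erase a)
    rw [fullBoundary_apply, Pi.zero_apply] at h0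
    have e : S \ F.erase a = insert a (S \ F) := by
      ext v
      simp only [Finset.mem_sdiff, Finset.mem_erase, Finset.mem_insert]
      by_cases h : v = a
      · simp [h, haS]
      · simp [h]
    rw [e, Finset.sum_insert (by simp [haF]), Finset.insert_erase haF, hmin F hF, one_smul] at h0
    rw [eq_comm, ← sub_eq_zero, ← h0, sub_eq_add_neg, ← Finset.sum_neg_distrib]
    congr 1
    refine Finset.sum_congr rfl fun v hv => ?_
    obtain ⟨hvS, hvF⟩ := Finset.mem_sdiff.1 hv
    have hav : a ≠ v := fun h => hvF (h ▸ haF)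
    have e1 : (insert v F).erase a = insert v (F.erase a) :=
      Finset.erase_insert_of_ne hav.symm
    have hs := koszulSign_swap (insert v F) a v (by simp [haF])
      (lt_of_le_of_ne (S.min'_le v hvS) hav)
    rw [Finset.erase_insert hvF, hmin F hF, hmin _ (Finset.insert_subset hvS hF), e1, one_mul,
      mul_one] at hs
    rw [hs, coneChain, if_pos (by simp [haF]), e1, neg_smul]
  -- When a ∉ F, only adding a itself produces a face of the cone.
  · rw [Finset.sum_eq_single a]
    · rw [hmin _ (Finset.insert_subset haS hF), one_smul, coneChain,
        if_pos (Finset.mem_insert_self _ _), Finset.erase_insert haF]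
    · intro v _ hva
      rw [coneChain, if_neg (by simp [haF, Ne.symm hva]), smul_zero]
    · intro h
      exact absurd (Finset.mem_sdiff.2 ⟨haS, haF⟩) h

end FullSimplex

/-! ### Alexander duality -/

section AlexanderDuality

variable (k : Type*) [Field k] {V : Type*} (Δ : SimplComplex V)

variable {k Δ} in
open Classical in
/-- The extension by zero of a simplicial cochain to all finite sets of vertices. -/
def cochainFun {q : ℤ} (φ : SimplCochain k Δ q) (G : Finset V) : k :=
  if h : G ∈ Δ ∧ (G.card : ℤ) = q + 1 then φ (Finsupp.single ⟨G, h⟩ 1) else 0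

variable {k Δ} in
theorem cochainFun_face {q : ℤ} (φ : SimplCochain k Δ q) (G : SimplFace Δ q) :
    cochainFun φ G.1 = φ (Finsupp.single G 1) :=
  dif_pos G.2

variable {k Δ} in
theorem cochainFun_eq_zero {q : ℤ} (φ : SimplCochain k Δ q) {G : Finset V}
    (h : ¬ (G ∈ Δ ∧ (G.card : ℤ) = q + 1)) : cochainFun φ G = 0 :=
  dif_neg h

variable {k Δ} in
theorem cochain_ext {q : ℤ} {φ ψ : SimplCochain k Δ q}
    (h : ∀ G : SimplFace Δ q, cochainFun φ G.1 = cochainFun ψ G.1) : φ = ψ := by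
  refine Finsupp.lhom_ext' fun G => LinearMap.ext_ring ?_
  have := h G
  rwa [cochainFun_face, cochainFun_face] at this

open Classical in
/-- The extension by zero of a simplicial chain to all finite sets of vertices. -/
def chainFun (p : ℤ) : SimplChain k Δ p →ₗ[k] (Finset V → k) where
  toFun c F := if h : F ∈ Δ ∧ (F.card : ℤ) = p + 1 then c ⟨F, h⟩ else 0
  map_add' c c' := by
    ext F
    simp only [Pi.add_apply]
    split_ifs
    · exact Finsupp.add_apply _ _ _
    · exact (add_zero 0).symm
  map_smul' a c := by
    ext F
    simp only [Pi.smul_apply, RingHom.id_apply]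
    split_ifs
    · exact Finsupp.smul_apply _ _ _
    · exact (smul_zero a).symm

variable {k Δ} in
theorem chainFun_face {p : ℤ} (c : SimplChain k Δ p) (F : SimplFace Δ p) :
    chainFun k Δ p c F.1 = c F :=
  dif_pos F.2

variable {k Δ} in
theorem chainFun_eq_zero {p : ℤ} (c : SimplChain k Δ p) {F : Finset V}
    (h : ¬ (F ∈ Δ ∧ (F.card : ℤ) = p + 1)) : chainFun k Δ p c F = 0 :=
  dif_neg h

theorem chainFun_injective (p : ℤ) : Function.Injective (chainFun k Δ p) := by
  intro c c' h
  refine Finsupp.ext fun F => ?_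
  rw [← chainFun_face, h, chainFun_face]

section Restrict

variable [Finite V]

instance (p : ℤ) : Finite (SimplFace Δ p) :=
  inferInstanceAs (Finite {F : Finset V // F ∈ Δ ∧ (F.card : ℤ) = p + 1})

/-- The simplicial chain with the given coefficients. -/
def restrictChain (p : ℤ) : (Finset V → k) →ₗ[k] SimplChain k Δ p :=
  (Finsupp.linearEquivFunOnFinite k k (SimplFace Δ p)).symm.toLinearMap ∘ₗ
    LinearMap.funLeft k k Subtype.val

theorem chainFun_restrictChain_face {p : ℤ} (w : Finset V → k) (F : SimplFace Δ p) :
    chainFun k Δ p (restrictChain k Δ p w) F.1 = w F.1 := by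
  rw [chainFun_face]
  rfl

theorem chainFun_restrictChain {p : ℤ} {w : Finset V → k}
    (hw : ∀ F, w F ≠ 0 → F ∈ Δ ∧ (F.card : ℤ) = p + 1) :
    chainFun k Δ p (restrictChain k Δ p w) = w := by
  ext F
  by_cases h : F ∈ Δ ∧ (F.card : ℤ) = p + 1
  · exact chainFun_restrictChain_face k Δ w ⟨F, h⟩
  · rw [chainFun_eq_zero _ h, not_ne_iff.1 (mt (hw F) h)]

end Restrict

variable [LinearOrder V]

theorem simplBoundary_single (p q : ℤ) (h : q + 1 = p) (F : SimplFace Δ p) :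
    simplBoundary k Δ p q h (Finsupp.single F 1) =
      ∑ v ∈ F.1.attach, koszulSign F.1 v.1 • Finsupp.single (F.erase h v.1 v.2) (1 : k) := by
  unfold simplBoundary
  rw [Finsupp.linearCombination_single, one_smul]

theorem cochainFun_simplCoboundary {q p : ℤ} (h : q + 1 = p) (φ : SimplCochain k Δ q)
    (G : SimplFace Δ p) :
    cochainFun (simplCoboundary k Δ q p h φ) G.1 =
      ∑ v ∈ G.1, koszulSign G.1 v • cochainFun φ (G.1.erase v) := by
  rw [cochainFun_face]
  change φ (simplBoundary k Δ p q h (Finsupp.single G 1)) = _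
  rw [simplBoundary_single, map_sum, ← Finset.sum_attach G.1]
  refine Finset.sum_congr rfl fun v _ => ?_
  rw [map_zsmul, ← cochainFun_face]
  rfl

theorem chainFun_single {p : ℤ} (F : SimplFace Δ p) (G : Finset V) :
    chainFun k Δ p (Finsupp.single F 1) G = if G = F.1 then 1 else 0 := by
  by_cases h : G ∈ Δ ∧ (G.card : ℤ) = p + 1
  · classical
    obtain ⟨G, rfl⟩ : ∃ G' : SimplFace Δ p, G'.1 = G := ⟨⟨G, h⟩, rfl⟩
    rw [chainFun_face, Finsupp.single_apply]
    exact if_congr ⟨fun h => h ▸ rfl, fun h => Subtype.ext h.symm⟩ rfl rfl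
  · rw [chainFun_eq_zero _ h, if_neg]
    rintro rfl
    exact h F.2

-- This makes Δ a subcomplex of the full simplex on S: the coefficient at H of the boundary of F
-- comes from the vertices v with F = H ∪ v, and all of these lie in S.
variable {Δ} in
theorem chainFun_simplBoundary {S : Finset V} (hΔ : ∀ F ∈ Δ, F ⊆ S) {p q : ℤ} (h : q + 1 = p)
    (c : SimplChain k Δ p) :
    chainFun k Δ q (simplBoundary k Δ p q h c) = fullBoundary k S (chainFun k Δ p c) := by
  suffices chainFun k Δ q ∘ₗ simplBoundary k Δ p q h = fullBoundary k S ∘ₗ chainFun k Δ p from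
    LinearMap.congr_fun this c
  refine Finsupp.lhom_ext' fun F => LinearMap.ext_ring ?_
  change chainFun k Δ q (simplBoundary k Δ p q h (Finsupp.single F 1)) =
    fullBoundary k S (chainFun k Δ p (Finsupp.single F 1))
  ext H
  rw [simplBoundary_single, map_sum, Finset.sum_apply, fullBoundary_apply]
  simp only [map_zsmul, Pi.smul_apply, chainFun_single]
  change ∑ v ∈ F.1.attach, koszulSign F.1 v.1 • (if H = F.1.erase v.1 then (1 : k) else 0) = _
  rw [Finset.sum_attach F.1
    (fun v => koszulSign F.1 v • (if H = F.1.erase v then (1 : k) else 0))]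
  simp only [smul_ite, smul_zero]
  rw [← Finset.sum_filter, ← Finset.sum_filter]
  refine Finset.sum_congr ?_ ?_
  · ext v
    simp only [Finset.mem_filter, Finset.mem_sdiff]
    constructor
    · rintro ⟨hv, rfl⟩
      exact ⟨⟨hΔ _ F.2.1 hv, by simp⟩, Finset.insert_erase hv⟩
    · rintro ⟨⟨hvS, hvH⟩, hF⟩
      exact ⟨by simp [← hF], by rw [← hF, Finset.erase_insert hvH]⟩
  · intro v hv
    rw [(Finset.mem_filter.1 hv).2]

/-- The map taking a cochain to a chain of the full simplex on `S`, by taking complements in `S`. -/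
def complChain (S : Finset V) (q : ℤ) : SimplCochain k Δ q →ₗ[k] (Finset V → k) where
  toFun φ F := if F ⊆ S then complSign S F • cochainFun φ (S \ F) else 0
  map_add' φ ψ := by
    ext F
    simp only [Pi.add_apply, cochainFun]
    split_ifs <;> simp
  map_smul' a φ := by
    ext F
    simp only [Pi.smul_apply, RingHom.id_apply, cochainFun]
    split_ifs <;> simp [mul_left_comm]

variable {k Δ} in
theorem complChain_of_subset {S F : Finset V} (hF : F ⊆ S) {q : ℤ} (φ : SimplCochain k Δ q) :
    complChain k Δ S q φ F = complSign S F • cochainFun φ (S \ F) :=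
  if_pos hF

variable {k Δ} in
theorem complChain_eq_zero {S F : Finset V} {q : ℤ} (φ : SimplCochain k Δ q)
    (h : ¬ (F ⊆ S ∧ S \ F ∈ Δ ∧ ((S \ F).card : ℤ) = q + 1)) :
    complChain k Δ S q φ F = 0 := by
  by_cases hF : F ⊆ S
  · rw [complChain_of_subset hF, cochainFun_eq_zero φ fun h' => h ⟨hF, h'⟩, smul_zero]
  · exact if_neg hF

theorem complChain_injective {S : Finset V} (hΔ : ∀ F ∈ Δ, F ⊆ S) (q : ℤ) :
    Function.Injective (complChain k Δ S q) := by
  intro φ ψ h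
  refine cochain_ext fun G => ?_
  have := congrFun h (S \ G.1)
  rw [complChain_of_subset Finset.sdiff_subset, complChain_of_subset Finset.sdiff_subset,
    Finset.sdiff_sdiff_eq_self (hΔ _ G.2.1)] at this
  have h2 := congrArg (fun x => complSign S (S \ G.1) • x) this
  simpa only [smul_smul, complSign_mul_self, one_smul] using h2

theorem exists_complChain_eq {S : Finset V} {q : ℤ} {w : Finset V → k}
    (hw : ∀ F, w F ≠ 0 → F ⊆ S ∧ S \ F ∈ Δ ∧ ((S \ F).card : ℤ) = q + 1) :
    ∃ φ, complChain k Δ S q φ = w := by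
  -- The signs square to 1, so multiplying by the same sign inverts the passage to complements.
  refine ⟨Finsupp.linearCombination k fun G : SimplFace Δ q =>
    complSign S (S \ G.1) • w (S \ G.1), ?_⟩
  ext F
  by_cases h : F ⊆ S ∧ S \ F ∈ Δ ∧ ((S \ F).card : ℤ) = q + 1
  · have hG : cochainFun (Finsupp.linearCombination k fun G : SimplFace Δ q =>
        complSign S (S \ G.1) • w (S \ G.1)) (S \ F) =
        complSign S (S \ (S \ F)) • w (S \ (S \ F)) :=
      (cochainFun_face _ (⟨S \ F, h.2⟩ : SimplFace Δ q)).trans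
        ((Finsupp.linearCombination_single k _ _).trans (one_smul k _))
    rw [complChain_of_subset h.1, hG, Finset.sdiff_sdiff_eq_self h.1, smul_smul,
      complSign_mul_self, one_smul]
  · rw [complChain_eq_zero _ h, not_ne_iff.1 (mt (hw F) h)]

/-- Taking complements turns coboundaries into boundaries. -/
theorem complChain_simplCoboundary {S F : Finset V} {q p : ℤ} (h : q + 1 = p)
    (φ : SimplCochain k Δ q) (hF : F ⊆ S) (hF' : S \ F ∈ Δ)
    (hc : ((S \ F).card : ℤ) = p + 1) :
    complChain k Δ S p (simplCoboundary k Δ q p h φ) F =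
      fullBoundary k S (complChain k Δ S q φ) F := by
  rw [complChain_of_subset hF, fullBoundary_apply,
    cochainFun_simplCoboundary k Δ h φ ⟨S \ F, hF', hc⟩, Finset.smul_sum]
  -- Erasing v from S∖F amounts to adding v to F, so the two sums run over the same v and only the
  -- signs need comparison.
  refine Finset.sum_congr rfl fun v hv => ?_
  obtain ⟨hvS, hvF⟩ := Finset.mem_sdiff.1 hv
  rw [complChain_of_subset (Finset.insert_subset hvS hF), smul_smul, smul_smul,
    koszulSign_mul_complSign_insert hF hvF, Finset.sdiff_insert]

variable {k Δ} in
theorem fullBoundary_support {S : Finset V} {w : Finset V → k} {c : ℤ}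
    (hw : ∀ F, w F ≠ 0 → F ⊆ S ∧ (F.card : ℤ) = c + 1) (F : Finset V)
    (hF : fullBoundary k S w F ≠ 0) : F ⊆ S ∧ (F.card : ℤ) = c := by
  rw [fullBoundary_apply] at hF
  obtain ⟨v, hv, h⟩ := Finset.exists_ne_zero_of_sum_ne_zero hF
  have h' := hw _ (right_ne_zero_of_smul h)
  rw [Finset.card_insert_of_notMem (Finset.mem_sdiff.1 hv).2] at h'
  exact ⟨(Finset.subset_insert _ _).trans h'.1, by have := h'.2; push_cast at this; omega⟩

/-- Acyclicity with control of the support: coning stays inside S and raises the cardinality by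
exactly one. -/
theorem exists_fullBoundary_eq {S : Finset V} (hS : S.Nonempty) {w : Finset V → k} {c : ℤ}
    (hw : ∀ F, w F ≠ 0 → F ⊆ S ∧ (F.card : ℤ) = c) (hD : fullBoundary k S w = 0) :
    ∃ u : Finset V → k, (∀ F, u F ≠ 0 → F ⊆ S ∧ (F.card : ℤ) = c + 1) ∧
      fullBoundary k S u = w := by
  refine ⟨_, fun F hF => ?_, fullBoundary_coneChain_min' hS (fun F hF => (hw F hF).1) hD⟩
  unfold coneChain at hF
  rw [ite_ne_right_iff] at hF
  obtain ⟨haF, hF⟩ := hF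
  obtain ⟨h1, h2⟩ := hw _ hF
  refine ⟨?_, ?_⟩
  · rw [← Finset.insert_erase haF]
    exact Finset.insert_subset (S.min'_mem hS) h1
  · rw [← h2, ← Finset.card_erase_add_one haF]
    push_cast
    rfl

/-- Alexander duality: if `Γ` consists of the complements in `S` of the nonfaces of `Δ`, then the
reduced homology of `Δ` is isomorphic to the reduced cohomology of `Γ` in complementary degree. -/
theorem alexanderDuality [Finite V] (Γ : SimplComplex V) {S : Finset V} (hS : S.Nonempty)
    (hΔ : ∀ F ∈ Δ, F ⊆ S) (hΓ : ∀ G, G ∈ Γ ↔ G ⊆ S ∧ S \ G ∉ Δ) {p q : ℤ}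
    (hpq : p + q + 3 = S.card) :
    Nonempty (ReducedHomology k Δ p ≃ₗ[k] ReducedCohomology k Γ q) := by
  classical
  have hΓS : ∀ G ∈ Γ, G ⊆ S := fun G hG => ((hΓ G).1 hG).1
  have hmem : ∀ F, F ⊆ S → (S \ F ∈ Γ ↔ F ∉ Δ) := fun F hF => by
    rw [hΓ, Finset.sdiff_sdiff_eq_self hF]
    simp
  have hcard : ∀ F, F ⊆ S → (((S \ F).card : ℤ) = S.card - F.card) := fun F hF => by
    rw [Finset.card_sdiff_of_subset hF, Nat.cast_sub (Finset.card_le_card hF)]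
  -- A face of Γ of dimension q has q + 1 vertices, so its complement has |S| - q - 1 = p + 2 of
  -- them and dimension p + 1.
  have hsupp : ∀ φ : SimplCochain k Γ q, ∀ F, complChain k Γ S q φ F ≠ 0 →
      F ⊆ S ∧ (F.card : ℤ) = p + 1 + 1 := fun φ F hF => by
    obtain ⟨h1, h2, h3⟩ := not_not.1 (mt (complChain_eq_zero φ) hF)
    rw [hcard F h1] at h3
    exact ⟨h1, by omega⟩
  have hsupp' : ∀ c : SimplChain k Δ (p + 1), ∀ F, chainFun k Δ (p + 1) c F ≠ 0 →
      F ⊆ S ∧ (F.card : ℤ) = p + 1 + 1 := fun c F hF => by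
    obtain ⟨h1, h2⟩ := not_not.1 (mt (chainFun_eq_zero c) hF)
    exact ⟨hΔ F h1, h2⟩
  -- The complement of the part of a chain supported on `Δ` comes from a cochain of `Γ`.
  have hsplit : ∀ (a b : ℤ), a + b + 2 = S.card → ∀ u : Finset V → k,
      (∀ F, u F ≠ 0 → F ⊆ S ∧ (F.card : ℤ) = a + 1) →
      ∃ φ : SimplCochain k Γ b,
        u = complChain k Γ S b φ + chainFun k Δ a (restrictChain k Δ a u) := by
    intro a b hab u hu
    obtain ⟨φ, hφ⟩ := exists_complChain_eq k Γ (S := S) (q := b)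
      (w := u - chainFun k Δ a (restrictChain k Δ a u)) (fun F hF => by
        have h1 : F ∉ Δ := by
          intro h
          by_cases hc : (F.card : ℤ) = a + 1
          · refine hF ?_
            rw [Pi.sub_apply, chainFun_restrictChain_face k Δ u ⟨F, h, hc⟩, sub_self]
          · refine hF ?_
            rw [Pi.sub_apply, chainFun_eq_zero _ fun h' => hc h'.2,
              not_ne_iff.1 fun h' => hc (hu F h').2, sub_self]
        rw [Pi.sub_apply, chainFun_eq_zero _ fun h' => h1 h'.1, sub_zero] at hF
        obtain ⟨h2, h3⟩ := hu F hF
        refine ⟨h2, (hmem F h2).2 h1, ?_⟩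
        rw [hcard F h2]
        omega)
    exact ⟨φ, by rw [hφ, sub_add_cancel]⟩
  -- Cocycles are the cochains whose associated chain has its boundary in `Δ`.
  have hcocycle : ∀ φ : SimplCochain k Γ q, φ ∈ simplCocycles k Γ q ↔
      ∀ F, fullBoundary k S (complChain k Γ S q φ) F ≠ 0 → F ∈ Δ ∧ (F.card : ℤ) = p + 1 := by
    intro φ
    rw [simplCocycles, LinearMap.mem_ker]
    constructor
    · intro h F hF
      obtain ⟨h1, h2⟩ := fullBoundary_support (hsupp φ) F hF
      refine ⟨?_, h2⟩
      by_contra h3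
      refine hF ?_
      rw [← complChain_simplCoboundary k Γ rfl φ h1 ((hmem F h1).2 h3)
        (by rw [hcard F h1]; omega), h, map_zero, Pi.zero_apply]
    · intro h
      refine complChain_injective k Γ hΓS (q + 1) ?_
      rw [map_zero]
      ext F
      by_cases hF : F ⊆ S ∧ S \ F ∈ Γ ∧ ((S \ F).card : ℤ) = q + 1 + 1
      · rw [complChain_simplCoboundary k Γ rfl φ hF.1 hF.2.1 hF.2.2]
        exact not_ne_iff.1 fun h' => (hmem F hF.1).1 hF.2.1 (h F h').1
      · rw [complChain_eq_zero _ hF, Pi.zero_apply]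
  -- The connecting map of the pair: lift the relative chain to the full simplex and take its
  -- boundary. For a cocycle this boundary already lies in Δ, so restricting it loses nothing.
  let f : SimplCochain k Γ q →ₗ[k] SimplChain k Δ p :=
    restrictChain k Δ p ∘ₗ fullBoundary k S ∘ₗ complChain k Γ S q
  have hf : ∀ φ ∈ simplCocycles k Γ q,
      chainFun k Δ p (f φ) = fullBoundary k S (complChain k Γ S q φ) := fun φ hφ =>
    chainFun_restrictChain k Δ ((hcocycle φ).1 hφ)
  suffices Nonempty (ReducedCohomology k Γ q ≃ₗ[k] ReducedHomology k Δ p) from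
    this.map LinearEquiv.symm
  refine nonempty_cyclesModBoundaries_equiv f (fun φ hφ => ?_) (fun φ hφ => ⟨?_, ?_⟩)
    (fun z hz => ?_)
  · refine LinearMap.mem_ker.2 (chainFun_injective k Δ _ ?_)
    rw [chainFun_simplBoundary k hΔ, hf φ hφ, fullBoundary_fullBoundary, map_zero]
  -- Injectivity: if f φ = ∂c, then the chain of φ minus c is a cycle of the full simplex, hence
  -- some ∂u. The part of u outside Δ comes from a cochain whose coboundary is φ.
  · rintro ⟨c, hc⟩
    have h1 := congrArg (chainFun k Δ p) hc
    rw [chainFun_simplBoundary k hΔ, hf φ hφ] at h1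
    obtain ⟨u, hu, hu'⟩ := exists_fullBoundary_eq k hS (c := p + 1 + 1)
      (w := complChain k Γ S q φ - chainFun k Δ (p + 1) c) (fun F hF => by
        by_cases h2 : complChain k Γ S q φ F = 0
        · refine hsupp' c F fun h3 => hF ?_
          rw [Pi.sub_apply, h2, h3, sub_zero]
        · exact hsupp φ F h2) (by rw [map_sub, h1, sub_self])
    obtain ⟨ψ, hψ⟩ := hsplit (p + 1 + 1) (q - 1) (by omega) u hu
    refine ⟨ψ, complChain_injective k Γ hΓS q ?_⟩
    ext F
    by_cases hF : F ⊆ S ∧ S \ F ∈ Γ ∧ ((S \ F).card : ℤ) = q + 1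
    · rw [complChain_simplCoboundary k Γ _ ψ hF.1 hF.2.1 hF.2.2]
      have hFΔ := (hmem F hF.1).1 hF.2.1
      have h3 := congrFun hu' F
      rw [hψ, map_add, ← chainFun_simplBoundary k hΔ (q := p + 1) rfl, Pi.add_apply, Pi.sub_apply,
        chainFun_eq_zero _ fun h' => hFΔ h'.1, chainFun_eq_zero _ fun h' => hFΔ h'.1, add_zero,
        sub_zero] at h3
      exact h3
    · rw [complChain_eq_zero _ hF, complChain_eq_zero _ hF]
  -- The full boundary u of the chain of ψ splits into the chain of the coboundary of ψ and a part
  -- in Δ. As ∂u = 0, f of the coboundary is minus the boundary of that part.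
  · rintro ⟨ψ, rfl⟩
    let u := fullBoundary k S (complChain k Γ S (q - 1) ψ)
    have hu : ∀ F, u F ≠ 0 → F ⊆ S ∧ (F.card : ℤ) = p + 1 + 1 := by
      refine fullBoundary_support fun F hF => ?_
      obtain ⟨h1, h2, h3⟩ := not_not.1 (mt (complChain_eq_zero ψ) hF)
      rw [hcard F h1] at h3
      exact ⟨h1, by omega⟩
    obtain ⟨χ, hχ⟩ := hsplit (p + 1) q (by omega) u hu
    have hχ' : simplCoboundary k Γ (q - 1) q (sub_add_cancel q 1) ψ = χ := by
      refine complChain_injective k Γ hΓS q ?_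
      ext F
      by_cases hF : F ⊆ S ∧ S \ F ∈ Γ ∧ ((S \ F).card : ℤ) = q + 1
      · rw [complChain_simplCoboundary k Γ _ ψ hF.1 hF.2.1 hF.2.2]
        have h3 := congrFun hχ F
        rwa [Pi.add_apply, chainFun_eq_zero _ fun h' => (hmem F hF.1).1 hF.2.1 h'.1,
          add_zero] at h3
      · rw [complChain_eq_zero _ hF, complChain_eq_zero _ hF]
    refine ⟨-restrictChain k Δ (p + 1) u, chainFun_injective k Δ p ?_⟩
    rw [hf _ hφ, chainFun_simplBoundary k hΔ, hχ', eq_sub_of_add_eq hχ.symm, map_sub, map_neg,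
      map_neg, fullBoundary_fullBoundary, zero_sub]
  -- Surjectivity: z bounds some u in the full simplex. The part of u outside Δ gives the cocycle φ,
  -- and the part in Δ bounds z - f φ.
  · have h0 : fullBoundary k S (chainFun k Δ p z) = 0 := by
      rw [← chainFun_simplBoundary k hΔ (q := p - 1) (sub_add_cancel p 1),
        LinearMap.mem_ker.1 hz, map_zero]
    obtain ⟨u, hu, hu'⟩ := exists_fullBoundary_eq k hS (c := p + 1) (w := chainFun k Δ p z)
      (fun F hF => by
        obtain ⟨h1, h2⟩ := not_not.1 (mt (chainFun_eq_zero z) hF)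
        exact ⟨hΔ F h1, h2⟩) h0
    obtain ⟨φ, hφ⟩ := hsplit (p + 1) q (by omega) u hu
    have h1 : fullBoundary k S (complChain k Γ S q φ) =
        chainFun k Δ p (z - simplBoundary k Δ (p + 1) p rfl (restrictChain k Δ (p + 1) u)) := by
      rw [map_sub, chainFun_simplBoundary k hΔ, ← hu', eq_sub_of_add_eq hφ.symm, map_sub]
    have h2 : φ ∈ simplCocycles k Γ q := by
      rw [hcocycle, h1]
      exact fun F hF => not_not.1 (mt (chainFun_eq_zero _) hF)
    refine ⟨φ, h2, restrictChain k Δ (p + 1) u, chainFun_injective k Δ p ?_⟩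
    rw [map_sub, hf φ h2, h1, map_sub, sub_sub_cancel]

end AlexanderDuality

/-! ### Faces as chains -/

section FaceChain

variable (k : Type*) [Field k] {V : Type*} (Δ : SimplComplex V)

open Classical in
/-- The generator of the simplicial chains corresponding to `t`, or `0` if `t` is not a face of the
right dimension. -/
def faceChain (p : ℤ) (t : Finset V) : SimplChain k Δ p :=
  if h : t ∈ Δ ∧ (t.card : ℤ) = p + 1 then Finsupp.single ⟨t, h⟩ 1 else 0

theorem faceChain_face {p : ℤ} (F : SimplFace Δ p) :
    faceChain k Δ p F.1 = Finsupp.single F 1 :=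
  dif_pos F.2

theorem faceChain_eq_zero {p : ℤ} {t : Finset V} (h : t ∉ Δ) : faceChain k Δ p t = 0 :=
  dif_neg fun h' => h h'.1

theorem simplBoundary_face [LinearOrder V] {p q : ℤ} (h : q + 1 = p) (F : SimplFace Δ p) :
    simplBoundary k Δ p q h (faceChain k Δ p F.1) =
      ∑ v ∈ F.1.attach, koszulSign F.1 v.1 • faceChain k Δ q (F.1.erase v.1) := by
  rw [faceChain_face, simplBoundary_single]
  refine Finset.sum_congr rfl fun v _ => ?_
  rw [← faceChain_face]
  rfl

end FaceChain

/-! ### Monomials -/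

section Monomial

variable {k : Type*} [Field k] {n : ℕ}

theorem sqfreeVec_apply (τ : Finset (Fin n)) (a : Fin n) :
    sqfreeVec τ a = if a ∈ τ then 1 else 0 := by
  classical
  simp [sqfreeVec, Finsupp.indicator_apply]

theorem sqfreeVec_erase_add_single {τ : Finset (Fin n)} {j : Fin n} (hj : j ∈ τ) :
    sqfreeVec (τ.erase j) + Finsupp.single j 1 = sqfreeVec τ := by
  ext a
  rw [Finsupp.add_apply, sqfreeVec_apply, sqfreeVec_apply, Finsupp.single_apply]
  by_cases h : a = j
  · simp [h, hj]
  · simp [h, Ne.symm h]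

/-- Every monomial occurring in an element of a monomial ideal is divisible by one of the generating
monomials. Monomiality of I enters the proof only through this. -/
theorem IsMonomialIdeal.monomial_mem {I : Ideal (MvPolynomial (Fin n) k)}
    (hI : IsMonomialIdeal I) {p : MvPolynomial (Fin n) k} (hp : p ∈ I) {a : Fin n →₀ ℕ}
    (ha : MvPolynomial.coeff a p ≠ 0) : MvPolynomial.monomial a (1 : k) ∈ I := by
  obtain ⟨A, rfl⟩ := hI
  obtain ⟨b, hb, hba⟩ :=
    MvPolynomial.mem_ideal_span_monomial_image.1 hp a (MvPolynomial.mem_support_iff.2 ha)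
  exact monomial_mem_of_le _ hba (Ideal.subset_span ⟨b, hb, rfl⟩)

/-- Given τ∖j ≤ μ, the variable x_j divides x^(μ-(τ∖j)) exactly when τ ≤ μ. -/
theorem coeff_X_mul_sqfreeVec_erase {μ : Fin n →₀ ℕ} {τ : Finset (Fin n)} {j : Fin n}
    [Decidable (sqfreeVec τ ≤ μ)] (hj : j ∈ τ) (h : sqfreeVec (τ.erase j) ≤ μ)
    (p : MvPolynomial (Fin n) k) :
    MvPolynomial.coeff (μ - sqfreeVec (τ.erase j)) (MvPolynomial.X j * p) =
      if sqfreeVec τ ≤ μ then MvPolynomial.coeff (μ - sqfreeVec τ) p else 0 := by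
  rw [MvPolynomial.coeff_X_mul']
  refine if_congr ?_ ?_ rfl
  · rw [← sqfreeVec_erase_add_single hj, add_comm, ← le_tsub_iff_right h, Finsupp.single_le_iff,
      Finsupp.mem_support_iff, Nat.one_le_iff_ne_zero]
  · rw [← sqfreeVec_erase_add_single hj, tsub_add_eq_tsub_tsub]

theorem X_mul_monomial_sqfreeVec {μ : Fin n →₀ ℕ} {τ : Finset (Fin n)} {j : Fin n}
    (hj : j ∈ τ) (h : sqfreeVec τ ≤ μ) :
    (MvPolynomial.X j * MvPolynomial.monomial (μ - sqfreeVec τ) 1 : MvPolynomial (Fin n) k) =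
      MvPolynomial.monomial (μ - sqfreeVec (τ.erase j)) 1 := by
  rw [MvPolynomial.X, MvPolynomial.monomial_mul, one_mul]
  congr 1
  rw [← sqfreeVec_erase_add_single hj] at h ⊢
  rw [tsub_add_eq_tsub_tsub, add_tsub_cancel_of_le]
  rw [add_comm] at h
  exact (le_tsub_iff_right ((sqfreeVec_mono (Finset.erase_subset j τ)).trans
    (by rw [← sqfreeVec_erase_add_single hj, add_comm]; exact h))).2 h

end Monomial

/-! ### The Koszul complex in a fixed multidegree -/

section Multidegree

variable {k : Type*} [Field k] {n : ℕ}

theorem koszulD_koszulBasis (i : ℕ) (s : Set.powersetCard (Fin n) (i + 1)) :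
    koszulD k n i (koszulBasis k n (i + 1) s) = ∑ j ∈ s.1.attach, koszulSign s.1 j.1 •
      ((MvPolynomial.X j.1 : MvPolynomial (Fin n) k) •
        koszulBasis k n i (cardErase s j.1 j.2)) := by
  unfold koszulD
  rw [Module.Basis.constr_basis]

section Module

variable {M : Type*} [AddCommGroup M] [Module k M] [Module (MvPolynomial (Fin n) k) M]
  [IsScalarTower k (MvPolynomial (Fin n) k) M]

theorem koszulDiff_koszulElem {i : ℕ} (m : M) (s : Set.powersetCard (Fin n) (i + 1)) :
    koszulDiff k n M i (koszulElem k m s) = ∑ j ∈ s.1.attach, koszulSign s.1 j.1 •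
      koszulElem k ((MvPolynomial.X j.1 : MvPolynomial (Fin n) k) • m) (cardErase s j.1 j.2) := by
  change m ⊗ₜ[MvPolynomial (Fin n) k] koszulD k n i (koszulBasis k n (i + 1) s) = _
  rw [koszulD_koszulBasis, TensorProduct.tmul_sum]
  refine Finset.sum_congr rfl fun j _ => ?_
  refine (map_zsmul (TensorProduct.mk (MvPolynomial (Fin n) k) M _ m) _ _).trans
    (congrArg (koszulSign s.1 j.1 • ·) ?_)
  exact (TensorProduct.smul_tmul _ _ _).symm

/-- Coordinates of Koszul chains with respect to the standard basis. -/
def koszulCoord (i : ℕ) : KoszulChain k n M i ≃ₗ[k] (Set.powersetCard (Fin n) i →₀ M) :=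
  LinearEquiv.restrictScalars (M := M ⊗[MvPolynomial (Fin n) k] KoszulTerm k n i) k
    (TensorProduct.equivFinsuppOfBasisRight (M := M) (koszulBasis k n i))

theorem koszulCoord_koszulElem {i : ℕ} (m : M) (s : Set.powersetCard (Fin n) i) :
    koszulCoord i (koszulElem k m s) = Finsupp.single s m := by
  classical
  refine (TensorProduct.equivFinsuppOfBasisRight_apply_tmul _ _ _).trans ?_
  rw [Module.Basis.repr_self, Finsupp.mapRange_single, one_smul]

theorem koszulChain_lhom_ext {N : Type*} [AddCommGroup N] [Module k N] {i : ℕ}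
    {f g : KoszulChain k n M i →ₗ[k] N}
    (h : ∀ m s, f (koszulElem k m s) = g (koszulElem k m s)) : f = g := by
  have key : f ∘ₗ (koszulCoord i).symm.toLinearMap = g ∘ₗ (koszulCoord i).symm.toLinearMap := by
    refine Finsupp.lhom_ext fun s m => ?_
    have := h m s
    rw [← koszulCoord_koszulElem (k := k)]
    simpa using this
  ext z
  simpa using LinearMap.congr_fun key (koszulCoord i z)

end Module

variable (I : Ideal (MvPolynomial (Fin n) k)) (μ : Fin n →₀ ℕ)

/-- The inclusion of the chains of the upper Koszul complex as the multidegree `μ` part of the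
Koszul complex of `I`. -/
def chainToKoszul (i : ℕ) (p : ℤ) (h : p + 1 = i) :
    SimplChain k (upperKoszulComplex I μ) p →ₗ[k] KoszulChain k n I i :=
  Finsupp.linearCombination k fun F =>
    koszulElem k (⟨MvPolynomial.monomial (μ - sqfreeVec F.1) 1, F.2.1.2⟩ : I)
      ⟨F.1, by have := F.2.2; exact Nat.cast_injective (R := ℤ) (this.trans h)⟩

theorem chainToKoszul_single {i : ℕ} {p : ℤ} (h : p + 1 = i)
    (F : SimplFace (upperKoszulComplex I μ) p) (hF : F.1.card = i) :
    chainToKoszul I μ i p h (Finsupp.single F 1) =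
      koszulElem k (⟨MvPolynomial.monomial (μ - sqfreeVec F.1) 1, F.2.1.2⟩ : I) ⟨F.1, hF⟩ := by
  unfold chainToKoszul
  rw [Finsupp.linearCombination_single, one_smul]

/-- The projection of the Koszul complex of `I` onto its multidegree `μ` part. -/
def koszulToChain (i : ℕ) (p : ℤ) :
    KoszulChain k n I i →ₗ[k] SimplChain k (upperKoszulComplex I μ) p :=
  -- If s is not ≤ μ, the truncated difference is a meaningless exponent, but then s is not a face
  -- and `faceChain` vanishes.
  (Finsupp.lsum k fun s : Set.powersetCard (Fin n) i =>
    (MvPolynomial.lcoeff k (μ - sqfreeVec s.1) ∘ₗ I.subtype.restrictScalars k).smulRight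
      (faceChain k (upperKoszulComplex I μ) p s.1)) ∘ₗ (koszulCoord i).toLinearMap

theorem koszulToChain_koszulElem {i : ℕ} (p : ℤ) (m : I) (s : Set.powersetCard (Fin n) i) :
    koszulToChain I μ i p (koszulElem k m s) =
      MvPolynomial.coeff (μ - sqfreeVec s.1) (m : MvPolynomial (Fin n) k) •
        faceChain k (upperKoszulComplex I μ) p s.1 := by
  unfold koszulToChain
  rw [LinearMap.comp_apply, LinearEquiv.coe_coe, koszulCoord_koszulElem, Finsupp.lsum_single]
  rfl

theorem koszulToChain_chainToKoszul {i : ℕ} {p : ℤ} (h : p + 1 = i)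
    (c : SimplChain k (upperKoszulComplex I μ) p) :
    koszulToChain I μ i p (chainToKoszul I μ i p h c) = c := by
  suffices koszulToChain I μ i p ∘ₗ chainToKoszul I μ i p h = LinearMap.id from
    LinearMap.congr_fun this c
  refine Finsupp.lhom_ext' fun F => LinearMap.ext_ring ?_
  change koszulToChain I μ i p (chainToKoszul I μ i p h (Finsupp.single F 1)) =
    Finsupp.single F 1
  rw [chainToKoszul_single I μ h F (Nat.cast_injective (R := ℤ) (F.2.2.trans h)),
    koszulToChain_koszulElem, MvPolynomial.coeff_monomial, if_pos rfl, one_smul]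
  exact faceChain_face k _ F

/-- The identity x_j · x^(μ-τ) = x^(μ-(τ∖j)) turns the Koszul differential into the simplicial
boundary. -/
theorem koszulDiff_chainToKoszul {i : ℕ} {p q : ℤ} (h : q + 1 = p) (hp : p + 1 = (i + 1 : ℕ))
    (hq : q + 1 = i) (c : SimplChain k (upperKoszulComplex I μ) p) :
    koszulDiff k n I i (chainToKoszul I μ (i + 1) p hp c) =
      chainToKoszul I μ i q hq (simplBoundary k (upperKoszulComplex I μ) p q h c) := by
  suffices koszulDiff k n I i ∘ₗ chainToKoszul I μ (i + 1) p hp =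
      chainToKoszul I μ i q hq ∘ₗ simplBoundary k (upperKoszulComplex I μ) p q h from
    LinearMap.congr_fun this c
  refine Finsupp.lhom_ext' fun F => LinearMap.ext_ring ?_
  change koszulDiff k n I i (chainToKoszul I μ (i + 1) p hp (Finsupp.single F 1)) =
    chainToKoszul I μ i q hq
      (simplBoundary k (upperKoszulComplex I μ) p q h (Finsupp.single F 1))
  rw [chainToKoszul_single I μ hp F (Nat.cast_injective (R := ℤ) (F.2.2.trans hp)),
    koszulDiff_koszulElem, simplBoundary_single, map_sum]
  refine Finset.sum_congr rfl fun j _ => ?_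
  rw [map_zsmul, chainToKoszul_single I μ hq _
    (Nat.cast_injective (R := ℤ) ((F.erase h j.1 j.2).2.2.trans hq))]
  congr 2
  exact Subtype.ext (X_mul_monomial_sqfreeVec j.2 F.2.1.1)

variable {I} in
theorem koszulToChain_koszulDiff (hI : IsMonomialIdeal I) {i : ℕ} {p q : ℤ} (h : q + 1 = p)
    (hp : p + 1 = (i + 1 : ℕ)) (z : KoszulChain k n I (i + 1)) :
    koszulToChain I μ i q (koszulDiff k n I i z) =
      simplBoundary k (upperKoszulComplex I μ) p q h (koszulToChain I μ (i + 1) p z) := by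
  classical
  suffices koszulToChain I μ i q ∘ₗ koszulDiff k n I i =
      simplBoundary k (upperKoszulComplex I μ) p q h ∘ₗ koszulToChain I μ (i + 1) p from
    LinearMap.congr_fun this z
  refine koszulChain_lhom_ext fun m s => ?_
  rw [LinearMap.comp_apply, LinearMap.comp_apply, koszulDiff_koszulElem, map_sum,
    koszulToChain_koszulElem, map_smul]
  simp only [map_zsmul, koszulToChain_koszulElem]
  have hs : s.1.card = i + 1 := s.2
  by_cases hsΔ : s.1 ∈ upperKoszulComplex I μ
  · rw [simplBoundary_face k _ h ⟨s.1, hsΔ, by rw [hs, hp]⟩, Finset.smul_sum]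
    refine Finset.sum_congr rfl fun j _ => ?_
    rw [smul_comm (MvPolynomial.coeff _ _)]
    congr 2
    refine (coeff_X_mul_sqfreeVec_erase j.2
      ((sqfreeVec_mono (Finset.erase_subset j.1 s.1)).trans hsΔ.1) _).trans ?_
    rw [if_pos hsΔ.1]
  · rw [faceChain_eq_zero k _ hsΔ, map_zero, smul_zero]
    refine Finset.sum_eq_zero fun j _ => ?_
    -- A nonface s may have a facet s∖j in the complex. A nonzero contribution there would force s ≤
    -- μ and x^(μ-s) ∈ I, making s a face.
    by_cases hj : s.1.erase j.1 ∈ upperKoszulComplex I μ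
    · have h0 : MvPolynomial.coeff (μ - sqfreeVec (s.1.erase j.1))
          (MvPolynomial.X j.1 * (m : MvPolynomial (Fin n) k)) = 0 := by
        rw [coeff_X_mul_sqfreeVec_erase j.2 hj.1]
        split_ifs with hle
        · exact not_ne_iff.1 fun h' => hsΔ ⟨hle, hI.monomial_mem m.2 h'⟩
        · rfl
      refine smul_eq_zero_of_right _ (smul_eq_zero_of_left h0 _)
    · rw [cardErase, faceChain_eq_zero k _ hj, smul_zero, smul_zero]

/-- The condition ν + τ = μ forces ν = μ - τ and τ ≤ μ, so the spanning elements of multidegree μ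
correspond to the faces. -/
theorem range_chainToKoszul {i : ℕ} {p : ℤ} (h : p + 1 = i) :
    LinearMap.range (chainToKoszul I μ i p h) = koszulMultidegree I i μ := by
  unfold chainToKoszul koszulMultidegree
  rw [Finsupp.range_linearCombination]
  congr 1
  ext z
  constructor
  · rintro ⟨F, rfl⟩
    exact ⟨_, F.2.1.2, ⟨F.1, Nat.cast_injective (R := ℤ) (F.2.2.trans h)⟩,
      tsub_add_cancel_of_le F.2.1.1, rfl⟩
  · rintro ⟨ν, hν, s, rfl, rfl⟩
    have hs : s.1.card = i := s.2
    have e : ν + sqfreeVec s.1 - sqfreeVec s.1 = ν := add_tsub_cancel_right _ _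
    refine ⟨⟨s.1, ⟨le_add_self, by rwa [e]⟩, by rw [hs, h]⟩, ?_⟩
    dsimp only
    congr 1
    exact Subtype.ext (congrArg (fun a => MvPolynomial.monomial a (1 : k)) e)

theorem chainToKoszul_mem_koszulCycles {i : ℕ} {p : ℤ} (h : p + 1 = i)
    (c : SimplChain k (upperKoszulComplex I μ) p) :
    chainToKoszul I μ i p h c ∈ koszulCycles k n I i ↔
      c ∈ simplCycles k (upperKoszulComplex I μ) p := by
  cases i with
  | zero =>
    -- Here p = -1, and there are no faces of dimension -2: every chain is a cycle, in agreement
    -- with the convention for Koszul cycles in degree 0.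
    have : IsEmpty (SimplFace (upperKoszulComplex I μ) (p - 1)) :=
      ⟨fun F => by have := F.2.2; push_cast at h; omega⟩
    exact iff_of_true trivial (Subsingleton.elim (α := SimplChain k _ (p - 1)) _ _)
  | succ i =>
    change koszulDiff k n I i _ = 0 ↔ simplBoundary k _ p (p - 1) _ c = 0
    have hq : p - 1 + 1 = (i : ℤ) := by push_cast at h; omega
    rw [koszulDiff_chainToKoszul I μ (sub_add_cancel p 1) h hq]
    refine map_eq_zero_iff _ (Function.LeftInverse.injective
      (koszulToChain_chainToKoszul I μ hq))

-- A Koszul chain bounding an element of multidegree μ need not be homogeneous. Its projection by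
-- `koszulToChain` has the same boundary and lies in the strand.
variable {I} in
theorem chainToKoszul_mem_koszulBoundaries (hI : IsMonomialIdeal I) {i : ℕ} {p : ℤ}
    (h : p + 1 = i) (c : SimplChain k (upperKoszulComplex I μ) p) :
    chainToKoszul I μ i p h c ∈ koszulBoundaries k n I i ↔
      c ∈ simplBoundaries k (upperKoszulComplex I μ) p := by
  have h' : p + 1 + 1 = ((i + 1 : ℕ) : ℤ) := by push_cast; omega
  constructor
  · rintro ⟨y, hy⟩
    refine ⟨koszulToChain I μ (i + 1) (p + 1) y, ?_⟩
    rw [← koszulToChain_koszulDiff μ hI (p := p + 1) (q := p) rfl h', hy,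
      koszulToChain_chainToKoszul]
  · rintro ⟨y, rfl⟩
    exact ⟨chainToKoszul I μ (i + 1) (p + 1) h' y, koszulDiff_chainToKoszul I μ rfl h' h y⟩

variable {I} in
/-- The multigraded Koszul homology of a monomial ideal is the reduced homology of its upper
Koszul complex. -/
theorem nonempty_multigradedKoszulHomology_equiv (hI : IsMonomialIdeal I) {i : ℕ} {p : ℤ}
    (h : p + 1 = i) :
    Nonempty (multigradedKoszulHomology I i μ ≃ₗ[k]
      ReducedHomology k (upperKoszulComplex I μ) p) := by
  let Δ := upperKoszulComplex I μ
  let g := chainToKoszul I μ i p h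
  let T : simplCycles k Δ p →ₗ[k] KoszulHomology k n I i :=
    toHomologyClass (koszulCycles k n I i) (koszulBoundaries k n I i) ∘ₗ
      g.restrict fun c hc => (chainToKoszul_mem_koszulCycles I μ h c).2 hc
  have hker : (simplBoundaries k Δ p).submoduleOf (simplCycles k Δ p) = LinearMap.ker T := by
    ext c
    rw [LinearMap.mem_ker]
    refine (chainToKoszul_mem_koszulBoundaries μ hI h c.1).symm.trans ?_
    exact (Submodule.Quotient.mk_eq_zero
      (x := ⟨g c.1, (chainToKoszul_mem_koszulCycles I μ h c.1).2 c.2⟩)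
      ((koszulBoundaries k n I i).submoduleOf (koszulCycles k n I i))).symm
  have hrange : LinearMap.range T = multigradedKoszulHomology I i μ := by
    unfold multigradedKoszulHomology
    rw [LinearMap.range_comp]
    congr 1
    ext w
    change _ ↔ w.1 ∈ koszulMultidegree I i μ
    rw [← range_chainToKoszul I μ h]
    constructor
    · rintro ⟨c, rfl⟩
      exact ⟨c.1, rfl⟩
    · rintro ⟨c, hc⟩
      refine ⟨⟨c, (chainToKoszul_mem_koszulCycles I μ h c).1 (hc ▸ w.2)⟩, Subtype.ext hc⟩
  exact ⟨((Submodule.quotEquivOfEq _ _ hker).trans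
    (T.quotKerEquivRange.trans (LinearEquiv.ofEq _ _ hrange))).symm⟩

end Multidegree

/-! ### Duality between the upper and the lower Koszul complex -/

section Duality

variable {k : Type*} [Field k] {n : ℕ}

theorem sqfreeVec_le_iff {τ : Finset (Fin n)} {μ : Fin n →₀ ℕ} :
    sqfreeVec τ ≤ μ ↔ τ ⊆ μ.support := by
  constructor
  · intro h a ha
    have := h a
    rw [sqfreeVec_apply, if_pos ha] at this
    exact Finsupp.mem_support_iff.2 (Nat.one_le_iff_ne_zero.1 this)
  · intro h a
    rw [sqfreeVec_apply]
    split_ifs with ha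
    · exact Nat.one_le_iff_ne_zero.2 (Finsupp.mem_support_iff.1 (h ha))
    · exact Nat.zero_le _

/-- Lowering subtracts 1 on the whole support and adding τ restores it on τ, so the net effect is to
subtract 1 on the complement of τ. -/
theorem lowered_add_sqfreeVec {τ : Finset (Fin n)} {μ : Fin n →₀ ℕ} (h : τ ⊆ μ.support) :
    lowered μ + sqfreeVec τ = μ - sqfreeVec (μ.support \ τ) := by
  ext a
  rw [Finsupp.add_apply, Finsupp.tsub_apply, sqfreeVec_apply, sqfreeVec_apply, lowered,
    Finsupp.mapRange_apply]
  simp only [Finset.mem_sdiff, Finsupp.mem_support_iff]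
  by_cases ha : a ∈ τ
  · have := Finsupp.mem_support_iff.1 (h ha)
    simp only [ha, if_true, not_true_eq_false, and_false, if_false]
    omega
  · by_cases h0 : μ a = 0 <;> simp [ha, h0]

theorem mem_lowerKoszulComplex_iff {I : Ideal (MvPolynomial (Fin n) k)} {μ : Fin n →₀ ℕ}
    {G : Finset (Fin n)} :
    G ∈ lowerKoszulComplex I μ ↔
      G ⊆ μ.support ∧ μ.support \ G ∉ upperKoszulComplex I μ := by
  change sqfreeVec G ≤ μ ∧ MvPolynomial.monomial (lowered μ + sqfreeVec G) (1 : k) ∉ I ↔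
    G ⊆ μ.support ∧ ¬ (sqfreeVec (μ.support \ G) ≤ μ ∧
      MvPolynomial.monomial (μ - sqfreeVec (μ.support \ G)) (1 : k) ∈ I)
  rw [sqfreeVec_le_iff, sqfreeVec_le_iff]
  refine and_congr_right fun h => ?_
  rw [lowered_add_sqfreeVec h]
  simp

end Duality

end

theorem mainTheorem6 {k : Type*} [Field k] {n : ℕ} (I : Ideal (MvPolynomial (Fin n) k))
    (hI : IsMonomialIdeal I) (μ : Fin n →₀ ℕ) (i : ℕ) :
    Nonempty (multigradedKoszulHomology I i μ ≃ₗ[k]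
        ReducedHomology k (upperKoszulComplex I μ) ((i : ℤ) - 1)) ∧
      (I ≠ ⊤ ∨ μ ≠ 0 ∨ i ≠ 0 →
        Nonempty (ReducedHomology k (upperKoszulComplex I μ) ((i : ℤ) - 1) ≃ₗ[k]
          ReducedCohomology k (lowerKoszulComplex I μ) ((μ.support.card : ℤ) - (i : ℤ) - 2))) := by
  refine ⟨nonempty_multigradedKoszulHomology_equiv μ hI (sub_add_cancel _ _), fun h => ?_⟩
  have hupper : ∀ F ∈ upperKoszulComplex I μ, F ⊆ μ.support := fun F hF =>
    sqfreeVec_le_iff.1 hF.1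
  -- For μ = 0 the simplex on the empty support is not acyclic, so duality does not apply. The only
  -- possible face of the upper complex is then ∅, which counts in degree i - 1 only if i = 0 and is
  -- a face only if 1 ∈ I; this is the excluded case.
  rcases eq_or_ne μ 0 with rfl | hμ
  · have h1 : IsEmpty (SimplFace (upperKoszulComplex I 0) ((i : ℤ) - 1)) := by
      refine ⟨fun F => ?_⟩
      have hF : F.1 = ∅ := Finset.subset_empty.1 (by simpa using hupper F.1 F.2.1)
      have hc := F.2.2
      rw [hF, Finset.card_empty] at hc
      have hi : i = 0 := by push_cast at hc; omega
      have hm : MvPolynomial.monomial (0 - sqfreeVec F.1) (1 : k) ∈ I := F.2.1.2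
      rw [zero_tsub] at hm
      rcases h with h | h | h
      · exact h (I.eq_top_iff_one.2 hm)
      · exact h rfl
      · exact h hi
    -- The cohomological degree is -i - 2 ≤ -2, below the dimension of the empty face.
    have h2 : IsEmpty (SimplFace (lowerKoszulComplex I 0)
        (((0 : Fin n →₀ ℕ).support.card : ℤ) - i - 2)) := by
      refine ⟨fun F => ?_⟩
      have hc : (F.1.card : ℤ) = ((0 : Fin n →₀ ℕ).support.card : ℤ) - i - 2 + 1 := F.2.2
      have h0 : (0 : Fin n →₀ ℕ).support.card = 0 := rfl
      omega
    have h3 : Subsingleton (ReducedHomology k (upperKoszulComplex I 0) ((i : ℤ) - 1)) :=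
      subsingleton_cyclesModBoundaries _ _
    have h4 : Subsingleton (ReducedCohomology k (lowerKoszulComplex I 0)
        (((0 : Fin n →₀ ℕ).support.card : ℤ) - i - 2)) :=
      subsingleton_cyclesModBoundaries _ _
    exact ⟨0⟩
  · exact alexanderDuality k _ _ (Finsupp.support_nonempty_iff.2 hμ) hupper
      (fun G => mem_lowerKoszulComplex_iff) (by ring)
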